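/- Let $d\ge 1$, let $f$ be an arbitrary probability density on $\mathbb{R}^d$, and let $(r_n)$ be a sequence of nonnegative reals with $r_n\to 0$ and $n r_n^d\to\infty$. For each $n$ let $G_n$ be the random geometric graph on the vertex set $\{1,\dots,n\}$ built from i.i.d. random vectors $X_1,\dots,X_n$ with density $f$: distinct vertices $i,j$ are joined by an edge exactly when $\|X_i-X_j\|\le r_n$, where $\|\cdot\|$ is the Euclidean norm. Let $D_1$ be the degree of vertex $1$ in $G_n$, let $\delta_1$ be the number of edges of $G_n$ between neighbours of vertex $1$, and let $W_4=\delta_1/\binom{D_1}{2}$ be the local clustering coefficient of vertex $1$ (with $W_4=0$ when $D_1\le 1$). For $k\ge 1$ let $w_k=\mathbb{P}\{\|U-V\|\le 1\}$, where $U,V$ are independent and uniformly distributed in the unit ball of $\mathbb{R}^k$. Then, as $n\to\infty$, $$W_4\to w_d\quad\text{in probability.}$$ Consequently, if $\Delta_n$ is a function of $G_n$ (not depending on $d$, $f$ or $r_n$) with $\Delta_n\in\operatorname{argmin}_{k\ge 1}|W_4-w_k|$ whenever this minimum is attained (ties being broken arbitrarily, and $\Delta_n$ being an arbitrary natural number when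 the minimum is not attained, as for $W_4=0$), then $\Delta_n\to d$ in probability. -/

import Mathlib

open MeasureTheory ProbabilityTheory Filter Topology

/-- `ballConst k` is the probability that two independent points, both uniformly distributed in
the unit ball of `ℝ^k` (with its Euclidean norm), are at distance at most `1`. -/
noncomputable def ballConst (k : ℕ) : ℝ :=
  ((cond volume (Metric.closedBall (0 : EuclideanSpace ℝ (Fin k)) 1)).prod
    (cond volume (Metric.closedBall (0 : EuclideanSpace ℝ (Fin k)) 1))).real
      {p | ‖p.1 - p.2‖ ≤ 1}

/-- The geometric graph of the points `x i` with threshold `r`: distinct vertices `i`, `j` are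
joined when the Euclidean distance of `x i` and `x j` is at most `r`. -/
def geometricGraph {d n : ℕ} (r : ℝ) (x : Fin n → EuclideanSpace ℝ (Fin d)) :
    SimpleGraph (Fin n) where
  Adj i j := i ≠ j ∧ ‖x i - x j‖ ≤ r
  symm := ⟨fun i j h => ⟨h.1.symm, by rw [norm_sub_rev]; exact h.2⟩⟩
  loopless := ⟨fun _ h => h.1 rfl⟩

/-- The local clustering coefficient of `v`: the number of edges between neighbours of `v`,
divided by the number of pairs of neighbours (with value `0` when `v` has at most one
neighbour). -/
noncomputable def clusteringCoeff {V : Type*} (G : SimpleGraph V) (v : V) : ℝ :=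
  ((G.induce (G.neighborSet v)).edgeSet.ncard : ℝ) / ((G.neighborSet v).ncard.choose 2 : ℝ)

/-- The local clustering coefficient of the first vertex (`0` for the graph without vertices). -/
noncomputable def firstClusteringCoeff {n : ℕ} (G : SimpleGraph (Fin n)) : ℝ :=
  if h : 0 < n then clusteringCoeff G ⟨0, h⟩ else 0

/-- `k` is a value of `argmin_{k ≥ 1} |W - ballConst k|`. -/
def IsNearestDimension (W : ℝ) (k : ℕ) : Prop :=
  1 ≤ k ∧ ∀ j : ℕ, 1 ≤ j → |W - ballConst k| ≤ |W - ballConst j|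

/-- `Δ` computes from every finite graph a value of `argmin_{k ≥ 1} |W - ballConst k|`, where `W`
is the local clustering coefficient of the first vertex. Ties may be broken in any way, and `Δ` is
unrestricted on the graphs for which the minimum is not attained (which happens for `W = 0`). -/
def IsDimensionEstimate (Δ : (n : ℕ) → SimpleGraph (Fin n) → ℕ) : Prop :=
  ∀ (n : ℕ) (G : SimpleGraph (Fin n)),
    (∃ k, IsNearestDimension (firstClusteringCoeff G) k) →
      IsNearestDimension (firstClusteringCoeff G) (Δ n G)

/-! Fix the position `x` of vertex 1. The clustering coefficient is then a ratio of two pair counts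
over the remaining i.i.d. points: pairs in `closePairs x r` over pairs in `ballPairs x r`.
Normalised by the same quantity, numerator and denominator both concentrate. Covariances of pair
indicators vanish for disjoint index pairs and are otherwise at most `p ^ 2` or `p ^ 3`, with `p`
the mass of the ball, so the variance relative to the squared normalisation is of order `1 / (m p) ^
2 + 1 / (m p)` (`variance_pairCount_le`).

No regularity of `f` is needed: at a Lebesgue point `x` the density is close to `f x` in mean on
small balls, so the mass of `closePairs x r` over `p ^ 2` tends to its value for a uniform density,
`ballConst d`, and `m p` tends to infinity as soon as `f x > 0`
(`ae_tendsto_measureReal_closePairs_div`). Dominated convergence in `x` removes the conditioning.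

For the estimator it suffices that `ballConst d` is isolated among the values `ballConst k`, `k ≥
1`. Decomposing triangles by their longest side and slicing a lens gives the closed form
`ballConst_succ`, from which strict monotonicity follows (`ballConst_succ_lt`). Once the coefficient
is close enough to `ballConst d`, the dimension `d` is the unique minimiser. -/

theorem ballConst_mul_sq (k : ℕ) :
    ballConst k * (volume (Metric.closedBall (0 : EuclideanSpace ℝ (Fin k)) 1)).toReal ^ 2 =
      ((volume : Measure (EuclideanSpace ℝ (Fin k))).prod volume).real
        {p | ‖p.1‖ ≤ 1 ∧ ‖p.2‖ ≤ 1 ∧ ‖p.1 - p.2‖ ≤ 1} := by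
  set B := Metric.closedBall (0 : EuclideanSpace ℝ (Fin k)) 1 with hB
  have h0 : volume B ≠ 0 := (Metric.measure_closedBall_pos volume _ one_pos).ne'
  have h1 : volume B ≠ ⊤ := measure_closedBall_lt_top.ne
  have hS : MeasurableSet {p : EuclideanSpace ℝ (Fin k) × EuclideanSpace ℝ (Fin k) |
      ‖p.1 - p.2‖ ≤ 1} := measurableSet_le (by fun_prop) (by fun_prop)
  have e : {p : EuclideanSpace ℝ (Fin k) × EuclideanSpace ℝ (Fin k) | ‖p.1 - p.2‖ ≤ 1} ∩ B ×ˢ B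
      = {p | ‖p.1‖ ≤ 1 ∧ ‖p.2‖ ≤ 1 ∧ ‖p.1 - p.2‖ ≤ 1} := by
    ext p; simp [hB]; tauto
  have h2 : (volume B).toReal ≠ 0 := ENNReal.toReal_ne_zero.2 ⟨h0, h1⟩
  rw [ballConst, ProbabilityTheory.cond, Measure.prod_smul_left, Measure.prod_smul_right,
    Measure.prod_restrict, ← hB, measureReal_ennreal_smul_apply, measureReal_ennreal_smul_apply,
    measureReal_restrict_apply hS, e, ENNReal.toReal_inv]
  field_simp

/-! ### Triangles, longest sides and lenses. -/

section Lens

open scoped Pointwise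

variable {E : Type*} [NormedAddCommGroup E] [InnerProductSpace ℝ E] [FiniteDimensional ℝ E]
  [MeasurableSpace E] [BorelSpace E]

/-- Two balls of radius `‖u‖` with centers at distance `‖u‖` meet in a copy of the unit lens scaled
by `‖u‖`. -/
theorem volume_lens [Nontrivial E] {e : E} (he : ‖e‖ = 1) (u : E) :
    volume {v : E | ‖v‖ < ‖u‖ ∧ ‖u - v‖ < ‖u‖} =
      ENNReal.ofReal (‖u‖ ^ Module.finrank ℝ E) * volume {v : E | ‖v‖ < 1 ∧ ‖e - v‖ < 1} := by
  rcases eq_or_ne u 0 with rfl | hu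
  · have h : {v : E | ‖v‖ < ‖(0 : E)‖ ∧ ‖(0 : E) - v‖ < ‖(0 : E)‖} = ∅ := by
      ext v; simp [not_lt.2 (norm_nonneg v)]
    rw [h]; simp [Module.finrank_pos.ne']
  have hu' : 0 < ‖u‖ := norm_pos_iff.2 hu
  -- This reflection is an isometry taking `‖u‖ • e` to `u`, so only the direction `e` has to be
  -- treated.
  let ρ := (ℝ ∙ (‖u‖ • e - u))ᗮ.reflection
  have hρ : ρ (‖u‖ • e) = u := Submodule.reflection_sub (by simp [norm_smul, he])
  rw [← ρ.measurePreserving.measure_preimage_equiv (f := ρ.toMeasurableEquiv)]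
  have h : ρ.toMeasurableEquiv ⁻¹' {v : E | ‖v‖ < ‖u‖ ∧ ‖u - v‖ < ‖u‖} =
      (‖u‖ • {v : E | ‖v‖ < 1 ∧ ‖e - v‖ < 1} : Set E) := by
    ext v
    rw [Set.mem_smul_set_iff_inv_smul_mem₀ hu'.ne']
    have h1 : ‖u - ρ v‖ = ‖u‖ * ‖e - ‖u‖⁻¹ • v‖ := by
      nth_rw 1 [← hρ]
      rw [← map_sub, ρ.norm_map, ← norm_norm u, ← norm_smul, norm_norm, smul_sub,
        smul_inv_smul₀ hu'.ne']
    have h2 : ‖ρ v‖ = ‖u‖ * ‖‖u‖⁻¹ • v‖ := by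
      rw [ρ.norm_map, norm_smul, norm_inv, norm_norm, mul_inv_cancel_left₀ hu'.ne']
    change (‖ρ v‖ < ‖u‖ ∧ ‖u - ρ v‖ < ‖u‖) ↔ _
    rw [h1, h2]
    simp only [Set.mem_ofPred_eq, mul_lt_iff_lt_one_right hu']
  rw [h, Measure.addHaar_smul_of_nonneg _ hu'.le]

theorem volume_prod_norm_eq [Nontrivial E] :
    ((volume : Measure E).prod volume) {p : E × E | ‖p.1‖ = ‖p.2‖} = 0 := by
  rw [Measure.prod_apply (measurableSet_eq_fun (by fun_prop) (by fun_prop))]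
  refine (lintegral_congr fun u => ?_).trans lintegral_zero
  convert Measure.addHaar_sphere volume (0 : E) ‖u‖ using 2
  ext v; simp [eq_comm]

/-- Swapping coordinates exchanges the two strict orderings of the norms, and ties form a null set.
-/
theorem volume_prod_norm_lt [Nontrivial E] :
    2 * ((volume : Measure E).prod volume) {p : E × E | ‖p.1‖ ≤ 1 ∧ ‖p.2‖ < ‖p.1‖} =
      volume (Metric.closedBall (0 : E) 1) ^ 2 := by
  set μ := (volume : Measure E).prod (volume : Measure E)
  set S := {p : E × E | ‖p.1‖ ≤ 1 ∧ ‖p.2‖ < ‖p.1‖} with hSd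
  have hS : MeasurableSet S := by
    simp only [hSd, Set.ofPred_and]
    exact (measurableSet_le (by fun_prop) (by fun_prop)).inter
      (measurableSet_lt (by fun_prop) (by fun_prop))
  have hsw : μ (Prod.swap ⁻¹' S) = μ S :=
    (Measure.measurePreserving_swap (μ := (volume : Measure E)) (ν := volume)).measure_preimage
      hS.nullMeasurableSet
  have hd : Disjoint S (Prod.swap ⁻¹' S) := by
    rw [Set.disjoint_left]; rintro p ⟨_, h1⟩ ⟨_, h2⟩; exact lt_asymm h1 h2
  have hE : (S ∪ Prod.swap ⁻¹' S : Set (E × E)) =ᵐ[μ]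
      Metric.closedBall (0 : E) 1 ×ˢ Metric.closedBall (0 : E) 1 := by
    have h0 : ∀ᵐ p ∂μ, ¬ ‖p.1‖ = ‖p.2‖ := by
      rw [ae_iff]; simpa using volume_prod_norm_eq (E := E)
    filter_upwards [h0] with p hp
    refine propext ?_
    change ((‖p.1‖ ≤ 1 ∧ ‖p.2‖ < ‖p.1‖) ∨ (‖p.2‖ ≤ 1 ∧ ‖p.1‖ < ‖p.2‖)) ↔
      p ∈ Metric.closedBall (0 : E) 1 ×ˢ Metric.closedBall (0 : E) 1
    simp only [Set.mem_prod, mem_closedBall_zero_iff]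
    rcases lt_or_gt_of_ne hp with h | h
    · constructor
      · rintro (h1 | h1) <;> constructor <;> linarith
      · exact fun h1 => Or.inr ⟨h1.2, h⟩
    · constructor
      · rintro (h1 | h1) <;> constructor <;> linarith
      · exact fun h1 => Or.inl ⟨h1.1, h⟩
  rw [two_mul, pow_two, ← Measure.prod_prod, ← measure_congr hE,
    measure_union hd (hS.preimage measurable_swap), hsw]

/-- The fibre over `u`, be it a ball or a lens, has volume proportional to `‖u‖ ^ finrank`, so both
product volumes are multiples of one integral `J`. The ball case, known by symmetry, gives `2 * J =
V`; no polar coordinates are needed. -/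
theorem volume_prod_lens [Nontrivial E] {e : E} (he : ‖e‖ = 1) :
    2 * ((volume : Measure E).prod volume)
        {p : E × E | ‖p.1‖ ≤ 1 ∧ ‖p.2‖ < ‖p.1‖ ∧ ‖p.1 - p.2‖ < ‖p.1‖} =
      volume {v : E | ‖v‖ < 1 ∧ ‖e - v‖ < 1} * volume (Metric.closedBall (0 : E) 1) := by
  set J := ∫⁻ u in Metric.closedBall (0 : E) 1, ENNReal.ofReal (‖u‖ ^ Module.finrank ℝ E)
  set V := volume (Metric.closedBall (0 : E) 1)
  set L := volume {v : E | ‖v‖ < 1 ∧ ‖e - v‖ < 1}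
  have hV0 : V ≠ 0 := (Metric.measure_closedBall_pos volume _ one_pos).ne'
  have hV1 : V ≠ ⊤ := measure_closedBall_lt_top.ne
  have key : ∀ (S : E → Set E) (c : ENNReal), MeasurableSet {p : E × E | ‖p.1‖ ≤ 1 ∧ p.2 ∈ S p.1} →
      (∀ u, volume (S u) = ENNReal.ofReal (‖u‖ ^ Module.finrank ℝ E) * c) →
      ((volume : Measure E).prod volume) {p : E × E | ‖p.1‖ ≤ 1 ∧ p.2 ∈ S p.1} = J * c := by
    intro S c hm hS
    rw [Measure.prod_apply hm, ← lintegral_mul_const _ (by fun_prop),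
      ← lintegral_indicator measurableSet_closedBall]
    refine lintegral_congr fun u => ?_
    by_cases hu : ‖u‖ ≤ 1
    · rw [Set.indicator_of_mem (by simpa using hu), ← hS]
      congr 1; ext v; simp [hu]
    · rw [Set.indicator_of_notMem (by simpa using hu)]
      convert measure_empty (μ := (volume : Measure E))
      ext v; simp [hu]
  have m1 : MeasurableSet {p : E × E | ‖p.1‖ ≤ 1 ∧ ‖p.2‖ < ‖p.1‖} := by
    simp only [Set.ofPred_and]
    exact (measurableSet_le (by fun_prop) (by fun_prop)).inter
      (measurableSet_lt (by fun_prop) (by fun_prop))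
  have m2 : MeasurableSet {p : E × E | ‖p.1‖ ≤ 1 ∧ ‖p.2‖ < ‖p.1‖ ∧ ‖p.1 - p.2‖ < ‖p.1‖} := by
    simp only [Set.ofPred_and]
    exact (measurableSet_le (by fun_prop) (by fun_prop)).inter
      ((measurableSet_lt (by fun_prop) (by fun_prop)).inter
        (measurableSet_lt (by fun_prop) (by fun_prop)))
  have h1 : 2 * (J * V) = V ^ 2 := by
    rw [← volume_prod_norm_lt (E := E)]
    congr 1
    refine (key (fun u => {v | ‖v‖ < ‖u‖}) V m1 fun u => ?_).symm
    rw [show V = volume (Metric.ball (0 : E) 1) from Measure.addHaar_closedBall_eq_addHaar_ball _ _ _,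
      ← Measure.addHaar_ball volume (0 : E) (norm_nonneg u)]
    congr 1; ext v; simp
  have h2 := key (fun u => {v | ‖v‖ < ‖u‖ ∧ ‖u - v‖ < ‖u‖}) L m2 (volume_lens he)
  have h3 : 2 * J = V := by
    rw [← mul_assoc, pow_two] at h1
    exact (ENNReal.mul_left_inj hV0 hV1).1 h1
  rw [mul_comm L, ← h3, mul_assoc, ← h2]
  rfl

/-- Each of the three sides of a triangle is equally likely to be the longest one. -/
theorem volume_prod_triangle [Nontrivial E] :
    ((volume : Measure E).prod volume) {p : E × E | ‖p.1‖ ≤ 1 ∧ ‖p.2‖ ≤ 1 ∧ ‖p.1 - p.2‖ ≤ 1} =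
      3 * ((volume : Measure E).prod volume)
        {p : E × E | ‖p.1‖ ≤ 1 ∧ ‖p.2‖ < ‖p.1‖ ∧ ‖p.1 - p.2‖ < ‖p.1‖} := by
  set μ := (volume : Measure E).prod (volume : Measure E)
  set A := {p : E × E | ‖p.1‖ ≤ 1 ∧ ‖p.2‖ < ‖p.1‖ ∧ ‖p.1 - p.2‖ < ‖p.1‖} with hAd
  have hA : MeasurableSet A := by
    simp only [hAd, Set.ofPred_and]
    exact (measurableSet_le (by fun_prop) (by fun_prop)).inter
      ((measurableSet_lt (by fun_prop) (by fun_prop)).inter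
        (measurableSet_lt (by fun_prop) (by fun_prop)))
  have sw : MeasurePreserving Prod.swap μ μ := Measure.measurePreserving_swap
  have sb : MeasurePreserving (fun p : E × E => (p.1 - p.2, p.2)) μ μ :=
    measurePreserving_sub_prod volume volume
  -- Moving the vertex `p.2` of the triangle `0, p.1, p.2` to the origin permutes the sides. Thus
  -- `A`, `B`, `C` consist of the triangles whose longest side is `p.1`, `p.2`, `p.1 - p.2`
  -- respectively.
  have tri : MeasurePreserving (fun p : E × E => (p.1 - p.2, -p.2)) μ μ :=
    ((MeasurePreserving.id volume).prod (Measure.measurePreserving_neg volume)).comp sb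
  set B := Prod.swap ⁻¹' A
  set C := (fun p : E × E => (p.1 - p.2, -p.2)) ⁻¹' A
  have hB : MeasurableSet B := hA.preimage sw.measurable
  have hC : MeasurableSet C := hA.preimage tri.measurable
  have eB : μ B = μ A := sw.measure_preimage hA.nullMeasurableSet
  have eC : μ C = μ A := tri.measure_preimage hA.nullMeasurableSet
  have mB : ∀ p, p ∈ B ↔ ‖p.2‖ ≤ 1 ∧ ‖p.1‖ < ‖p.2‖ ∧ ‖p.1 - p.2‖ < ‖p.2‖ := fun p => by
    rw [norm_sub_rev]; rfl
  have mC : ∀ p, p ∈ C ↔ ‖p.1 - p.2‖ ≤ 1 ∧ ‖p.1‖ < ‖p.1 - p.2‖ ∧ ‖p.2‖ < ‖p.1 - p.2‖ := fun p => by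
    change (‖p.1 - p.2‖ ≤ 1 ∧ ‖-p.2‖ < ‖p.1 - p.2‖ ∧ ‖p.1 - p.2 - -p.2‖ < ‖p.1 - p.2‖) ↔ _
    rw [sub_neg_eq_add, sub_add_cancel, norm_neg, and_comm (a := ‖p.2‖ < _)]
  have hAB : Disjoint A B := by
    rw [Set.disjoint_left]; intro p h1 h2; rw [mB] at h2; exact lt_asymm h1.2.1 h2.2.1
  have hABC : Disjoint (A ∪ B) C := by
    rw [Set.disjoint_left]; rintro p (h1 | h1) h2 <;> rw [mC] at h2
    · exact lt_asymm h1.2.2 h2.2.1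
    · rw [mB] at h1; exact lt_asymm h1.2.2 h2.2.2
  have h0 : ∀ᵐ p ∂μ, ¬ ‖p.1‖ = ‖p.2‖ := by
    rw [ae_iff]; simpa using volume_prod_norm_eq (E := E)
  have h1 : ∀ᵐ p ∂μ, ¬ ‖p.1 - p.2‖ = ‖p.2‖ := sb.quasiMeasurePreserving.ae h0
  have h2 : ∀ᵐ p ∂μ, ¬ ‖p.2 - p.1‖ = ‖p.1‖ :=
    (sb.comp sw).quasiMeasurePreserving.ae h0
  have hE : (A ∪ B ∪ C : Set (E × E)) =ᵐ[μ]
      {p | ‖p.1‖ ≤ 1 ∧ ‖p.2‖ ≤ 1 ∧ ‖p.1 - p.2‖ ≤ 1} := by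
    filter_upwards [h0, h1, h2] with p h0 h1 h2
    rw [norm_sub_rev] at h2
    refine propext ?_
    change ((p ∈ A ∨ p ∈ B) ∨ p ∈ C) ↔ (‖p.1‖ ≤ 1 ∧ ‖p.2‖ ≤ 1 ∧ ‖p.1 - p.2‖ ≤ 1)
    rw [mB, mC]
    change (((‖p.1‖ ≤ 1 ∧ ‖p.2‖ < ‖p.1‖ ∧ ‖p.1 - p.2‖ < ‖p.1‖) ∨ _) ∨ _) ↔ _
    generalize ‖p.1‖ = a at *
    generalize ‖p.2‖ = b at *
    generalize ‖p.1 - p.2‖ = c at *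
    constructor
    · rintro ((h | h) | h) <;> refine ⟨?_, ?_, ?_⟩ <;> linarith
    · rintro ⟨ha, hb, hc⟩
      clear * - h0 h1 h2 ha hb hc
      grind
  rw [← measure_congr hE, measure_union hABC hC, measure_union hAB hB, eB, eC]
  ring

end Lens

/-! ### Closed form and strict monotonicity of the ball constants. -/

section Slices

/-- Fubini in the first coordinate: the slice at height `t` is a `j`-dimensional ball of radius `√(1
- t ^ 2)`. -/
theorem volume_ball_slice (j : ℕ) {S : Set ℝ} (hS : MeasurableSet S) :
    volume {v : EuclideanSpace ℝ (Fin (j + 1)) | ‖v‖ < 1 ∧ v 0 ∈ S} =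
      (∫⁻ t in S ∩ Set.Ioo (-1) 1, ENNReal.ofReal (√(1 - t ^ 2) ^ j)) *
        volume (Metric.ball (0 : EuclideanSpace ℝ (Fin j)) 1) := by
  have h1 := (EuclideanSpace.volume_preserving_symm_measurableEquiv_toLp (Fin (j + 1)))
  have h2 := volume_preserving_piFinSuccAbove (fun _ : Fin (j + 1) => ℝ) 0
  have h3 := (MeasurePreserving.id (volume : Measure ℝ)).prod
    (EuclideanSpace.volume_preserving_symm_measurableEquiv_toLp (Fin j)).symm
  have h := h3.comp (h2.comp h1)
  set T : Set (ℝ × EuclideanSpace ℝ (Fin j)) := {p | p.1 ^ 2 + ‖p.2‖ ^ 2 < 1 ∧ p.1 ∈ S} with hT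
  have mT : MeasurableSet T := by
    simp only [hT, Set.ofPred_and]
    exact (measurableSet_lt (by fun_prop) (by fun_prop)).inter (hS.preimage measurable_fst)
  have e := h.measure_preimage mT.nullMeasurableSet
  have e2 : {v : EuclideanSpace ℝ (Fin (j + 1)) | ‖v‖ < 1 ∧ v 0 ∈ S} =
      ((Prod.map id ⇑(MeasurableEquiv.toLp 2 (Fin j → ℝ)).symm.symm) ∘
        ((MeasurableEquiv.piFinSuccAbove (fun _ : Fin (j + 1) => ℝ) 0) ∘
          (MeasurableEquiv.toLp 2 (Fin (j + 1) → ℝ)).symm)) ⁻¹' T := by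
    ext v
    change _ ↔ (v 0 ^ 2 + ‖WithLp.toLp 2 (fun i : Fin j => v i.succ)‖ ^ 2 < 1 ∧ v 0 ∈ S)
    rw [EuclideanSpace.norm_sq_eq]
    simp only [Set.mem_ofPred_eq]
    rw [← sq_lt_one_iff₀ (norm_nonneg v), EuclideanSpace.norm_sq_eq, Fin.sum_univ_succ]
    simp
  rw [e2, e, Measure.prod_apply mT, ← lintegral_mul_const _ (by fun_prop),
    ← lintegral_indicator (hS.inter measurableSet_Ioo)]
  refine lintegral_congr fun t => ?_
  by_cases ht : t ∈ S ∩ Set.Ioo (-1) 1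
  · rw [Set.indicator_of_mem ht]
    have hpos : 0 < 1 - t ^ 2 := by nlinarith [ht.2.1, ht.2.2]
    have := Measure.addHaar_ball_of_pos (volume : Measure (EuclideanSpace ℝ (Fin j))) 0
      (Real.sqrt_pos.2 hpos)
    rw [finrank_euclideanSpace_fin] at this
    rw [← this]
    congr 1; ext y
    simp only [hT, Set.mem_preimage, Set.mem_ofPred_eq, mem_ball_zero_iff,
      Real.lt_sqrt (norm_nonneg y), ht.1, and_true]
    constructor <;> intro h <;> linarith
  · rw [Set.indicator_of_notMem ht]
    convert measure_empty (μ := (volume : Measure (EuclideanSpace ℝ (Fin j))))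
    ext y
    simp only [hT, Set.mem_preimage, Set.mem_ofPred_eq, Set.mem_empty_iff_false, iff_false]
    rintro ⟨h, h'⟩
    have : t ^ 2 < 1 := by nlinarith [sq_nonneg ‖y‖]
    exact ht ⟨h', by nlinarith, by nlinarith⟩

theorem toReal_volume_ball_slice (j : ℕ) (a : ℝ) (ha : -1 ≤ a) (ha' : a ≤ 1) :
    (volume {v : EuclideanSpace ℝ (Fin (j + 1)) | ‖v‖ < 1 ∧ a < v 0}).toReal =
      (∫ t in a..1, √(1 - t ^ 2) ^ j) *
        (volume (Metric.ball (0 : EuclideanSpace ℝ (Fin j)) 1)).toReal := by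
  have h := volume_ball_slice j (measurableSet_Ioi (a := a))
  have e : Set.Ioi a ∩ Set.Ioo (-1) 1 = Set.Ioo a 1 := by
    ext t
    simp only [Set.mem_inter_iff, Set.mem_Ioi, Set.mem_Ioo]
    exact ⟨fun h => ⟨h.1, h.2.2⟩, fun h => ⟨h.1, by linarith [h.1], h.2⟩⟩
  have hc : Continuous fun t : ℝ => √(1 - t ^ 2) ^ j := by fun_prop
  simp only [Set.mem_Ioi] at h
  rw [h, e, ENNReal.toReal_mul, intervalIntegral.integral_of_le ha', integral_Ioc_eq_integral_Ioo,
    integral_eq_lintegral_of_nonneg_ae (Eventually.of_forall fun t => by positivity)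
      hc.aestronglyMeasurable]

/-- The hyperplane `v 0 = 1 / 2` cuts the lens into two caps exchanged by `v ↦ e - v`; on either
side of it only one of the two ball conditions is binding. -/
theorem volume_lens_eq_two_mul_cap (j : ℕ) :
    volume {v : EuclideanSpace ℝ (Fin (j + 1)) |
      ‖v‖ < 1 ∧ ‖EuclideanSpace.single 0 (1 : ℝ) - v‖ < 1} =
      2 * volume {v : EuclideanSpace ℝ (Fin (j + 1)) | ‖v‖ < 1 ∧ 1 / 2 < v 0} := by
  set e : EuclideanSpace ℝ (Fin (j + 1)) := EuclideanSpace.single 0 1 with he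
  set C := {v : EuclideanSpace ℝ (Fin (j + 1)) | ‖v‖ < 1 ∧ 1 / 2 < v 0} with hC
  have mC : MeasurableSet C := by
    simp only [hC, Set.ofPred_and]
    exact (measurableSet_lt (by fun_prop) (by fun_prop)).inter
      (measurableSet_lt (by fun_prop) (by fun_prop))
  have rf := Measure.measurePreserving_sub_left (volume : Measure (EuclideanSpace ℝ (Fin (j + 1)))) e
  set C' := (fun v => e - v) ⁻¹' C with hC'
  have eC' : volume C' = volume C := rf.measure_preimage mC.nullMeasurableSet
  have nrm : ∀ v : EuclideanSpace ℝ (Fin (j + 1)), ‖e - v‖ ^ 2 = ‖v‖ ^ 2 + 1 - 2 * v 0 := by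
    intro v
    rw [EuclideanSpace.norm_sq_eq, EuclideanSpace.norm_sq_eq, Fin.sum_univ_succ, Fin.sum_univ_succ]
    simp [he]
    ring
  have mC' : ∀ v, v ∈ C' ↔ ‖e - v‖ < 1 ∧ v 0 < 1 / 2 := fun v => by
    simp only [hC', hC, Set.mem_preimage, Set.mem_ofPred_eq, PiLp.sub_apply, he]
    simp
    intro _
    constructor <;> intro h <;> linarith
  have hd : Disjoint C C' := by
    rw [Set.disjoint_left]; intro v h1 h2
    rw [mC'] at h2
    exact lt_asymm h1.2 h2.2
  have h0 : ∀ᵐ v : EuclideanSpace ℝ (Fin (j + 1)), v 0 ≠ 1 / 2 := by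
    have h1 := (EuclideanSpace.volume_preserving_symm_measurableEquiv_toLp (Fin (j + 1)))
    have h2 : ∀ᵐ x : Fin (j + 1) → ℝ, x 0 ≠ 1 / 2 := by
      rw [ae_iff, volume_pi]
      simpa using Measure.pi_hyperplane (fun _ : Fin (j + 1) => (volume : Measure ℝ)) 0 (1 / 2)
    exact h1.quasiMeasurePreserving.ae h2
  have hE : (C ∪ C' : Set _) =ᵐ[volume]
      {v : EuclideanSpace ℝ (Fin (j + 1)) | ‖v‖ < 1 ∧ ‖e - v‖ < 1} := by
    filter_upwards [h0] with v hv
    refine propext ?_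
    change (v ∈ C ∨ v ∈ C') ↔ ‖v‖ < 1 ∧ ‖e - v‖ < 1
    rw [mC']
    change ((‖v‖ < 1 ∧ 1 / 2 < v 0) ∨ _) ↔ _
    have h1 := nrm v
    rw [← sq_lt_one_iff₀ (norm_nonneg v), ← sq_lt_one_iff₀ (norm_nonneg (e - v))]
    rcases lt_or_gt_of_ne hv with h | h
    · constructor
      · rintro (h | h) <;> constructor <;> linarith
      · exact fun h' => Or.inr ⟨h'.2, h⟩
    · constructor
      · rintro (h | h) <;> constructor <;> linarith
      · exact fun h' => Or.inl ⟨h'.1, h⟩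
  rw [← measure_congr hE, measure_union hd (mC.preimage rf.measurable), eC', two_mul]

/-- The closed form of `ballConst`, from slicing the ball and the lens by parallel hyperplanes. -/
theorem ballConst_succ (j : ℕ) :
    ballConst (j + 1) =
      3 / 2 * ((∫ t in (1 / 2 : ℝ)..1, √(1 - t ^ 2) ^ j) / ∫ t in (0 : ℝ)..1, √(1 - t ^ 2) ^ j) := by
  set U := (volume (Metric.ball (0 : EuclideanSpace ℝ (Fin j)) 1)).toReal with hU
  have hU0 : U ≠ 0 := ENNReal.toReal_ne_zero.2
    ⟨(Metric.measure_ball_pos volume _ one_pos).ne', measure_ball_lt_top.ne⟩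
  set V := (volume (Metric.closedBall (0 : EuclideanSpace ℝ (Fin (j + 1))) 1)).toReal with hV
  have hV0 : V ≠ 0 := ENNReal.toReal_ne_zero.2
    ⟨(Metric.measure_closedBall_pos volume _ one_pos).ne', measure_closedBall_lt_top.ne⟩
  have hc : Continuous fun t : ℝ => √(1 - t ^ 2) ^ j := by fun_prop
  have eV : V = 2 * (∫ t in (0 : ℝ)..1, √(1 - t ^ 2) ^ j) * U := by
    have h1 := toReal_volume_ball_slice j (-1) le_rfl (by norm_num)
    have h2 : {v : EuclideanSpace ℝ (Fin (j + 1)) | ‖v‖ < 1 ∧ -1 < v 0} = Metric.ball 0 1 := by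
      ext v
      simp only [Set.mem_ofPred_eq, mem_ball_zero_iff, and_iff_left_iff_imp]
      intro h
      exact (abs_lt.1 ((PiLp.norm_apply_le v 0).trans_lt h)).1
    have h3 : (∫ t in (-1 : ℝ)..0, √(1 - t ^ 2) ^ j) = ∫ t in (0 : ℝ)..1, √(1 - t ^ 2) ^ j := by
      have := intervalIntegral.integral_comp_neg (a := 0) (b := 1) fun t : ℝ => √(1 - t ^ 2) ^ j
      simpa using this.symm
    rw [hV, Measure.addHaar_closedBall_eq_addHaar_ball, ← h2, h1,
      ← intervalIntegral.integral_add_adjacent_intervals (hc.intervalIntegrable (-1) 0)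
        (hc.intervalIntegrable 0 1), h3]
    ring
  -- The constant `3 / 2` combines 3 choices of longest side, the factor 2 in `volume_prod_lens`, 2
  -- caps per lens, and 2 half balls in `V`.
  have h1 := ballConst_mul_sq (j + 1)
  rw [← hV, measureReal_def, volume_prod_triangle] at h1
  have h2 := congrArg ENNReal.toReal (volume_prod_lens (E := EuclideanSpace ℝ (Fin (j + 1)))
    (e := EuclideanSpace.single 0 1) (by simp))
  rw [volume_lens_eq_two_mul_cap] at h2
  simp only [ENNReal.toReal_mul, ENNReal.toReal_ofNat] at h1 h2
  rw [toReal_volume_ball_slice j _ (by norm_num) (by norm_num), ← hU, ← hV] at h2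
  generalize (∫ t in (1 / 2 : ℝ)..1, √(1 - t ^ 2) ^ j) = a at *
  generalize (∫ t in (0 : ℝ)..1, √(1 - t ^ 2) ^ j) = b at *
  have hb : b ≠ 0 := by
    rintro rfl; simp at eV; exact hV0 eV
  have h3 : ballConst (j + 1) * V ^ 2 = 3 * (a * U) * V := by linarith
  have h4 : ballConst (j + 1) * V = 3 * (a * U) := by
    apply mul_right_cancel₀ hV0; linarith
  rw [eV] at h4
  field_simp
  apply mul_right_cancel₀ hU0
  linarith

/-- Raising `j` multiplies the integrand by `√(1 - t ^ 2)`, which is below its value `s` at `1 / 2`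
on `(1 / 2, 1)` and above `s` on `(0, 1 / 2)`. So the share of the integral carried by `(1 / 2, 1)`
drops. -/
theorem ballConst_succ_lt (j : ℕ) : ballConst (j + 2) < ballConst (j + 1) := by
  have hc : ∀ j, Continuous fun t : ℝ => √(1 - t ^ 2) ^ j := fun j => by fun_prop
  set s : ℝ := √(1 - (1 / 2) ^ 2)
  have hs : 0 < s := Real.sqrt_pos.2 (by norm_num)
  have hp : ∀ j (a b : ℝ), 0 ≤ a → b ≤ 1 → a < b → 0 < ∫ t in a..b, √(1 - t ^ 2) ^ j := by
    intro j a b ha hb hab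
    refine intervalIntegral.intervalIntegral_pos_of_pos_on ((hc j).intervalIntegrable _ _)
      (fun t ht => pow_pos (Real.sqrt_pos.2 ?_) j) hab
    nlinarith [ht.1, ht.2]
  have h1 : (∫ t in (1 / 2 : ℝ)..1, √(1 - t ^ 2) ^ (j + 1)) <
      s * ∫ t in (1 / 2 : ℝ)..1, √(1 - t ^ 2) ^ j := by
    rw [← intervalIntegral.integral_const_mul, ← sub_pos,
      ← intervalIntegral.integral_sub (((hc j).const_mul s).intervalIntegrable _ _)
        ((hc _).intervalIntegrable _ _)]
    refine intervalIntegral.intervalIntegral_pos_of_pos_on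
      ((((hc j).const_mul s).sub (hc _)).intervalIntegrable _ _) (fun t ht => ?_) (by norm_num)
    have h0 : 0 < 1 - t ^ 2 := by nlinarith [ht.1, ht.2]
    have h : √(1 - t ^ 2) < s := Real.sqrt_lt_sqrt h0.le (by nlinarith [ht.1, ht.2])
    rw [pow_succ' √(1 - t ^ 2) j]
    have := pow_pos (Real.sqrt_pos.2 h0) j
    nlinarith
  have h2 : s * (∫ t in (0 : ℝ)..(1 / 2), √(1 - t ^ 2) ^ j) <
      ∫ t in (0 : ℝ)..(1 / 2), √(1 - t ^ 2) ^ (j + 1) := by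
    rw [← intervalIntegral.integral_const_mul, ← sub_pos,
      ← intervalIntegral.integral_sub ((hc _).intervalIntegrable _ _)
        (((hc j).const_mul s).intervalIntegrable _ _)]
    refine intervalIntegral.intervalIntegral_pos_of_pos_on
      (((hc _).sub ((hc j).const_mul s)).intervalIntegrable _ _) (fun t ht => ?_) (by norm_num)
    have h0 : 0 < 1 - t ^ 2 := by nlinarith [ht.1, ht.2]
    have h : s < √(1 - t ^ 2) := Real.sqrt_lt_sqrt (by norm_num) (by nlinarith [ht.1, ht.2])
    rw [pow_succ' √(1 - t ^ 2) j]
    have := pow_pos (Real.sqrt_pos.2 h0) j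
    nlinarith
  have hsplit : ∀ j, (∫ t in (0 : ℝ)..1, √(1 - t ^ 2) ^ j) =
      (∫ t in (0 : ℝ)..(1 / 2), √(1 - t ^ 2) ^ j) + ∫ t in (1 / 2 : ℝ)..1, √(1 - t ^ 2) ^ j :=
    fun j => (intervalIntegral.integral_add_adjacent_intervals ((hc j).intervalIntegrable _ _)
      ((hc j).intervalIntegrable _ _)).symm
  have p1 := hp j (1 / 2) 1 (by norm_num) le_rfl (by norm_num)
  have p2 := hp (j + 1) (1 / 2) 1 (by norm_num) le_rfl (by norm_num)
  have p3 := hp j 0 (1 / 2) le_rfl (by norm_num) (by norm_num)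
  have p4 := hp (j + 1) 0 (1 / 2) le_rfl (by norm_num) (by norm_num)
  rw [ballConst_succ, ballConst_succ, hsplit, hsplit]
  refine mul_lt_mul_of_pos_left ?_ (by norm_num)
  rw [div_lt_div_iff₀ (by positivity) (by positivity)]
  have h3 := mul_lt_mul_of_pos_right h1 p3
  have h4 := mul_lt_mul_of_pos_left h2 p1
  linarith

theorem exists_ballConst_gap {d : ℕ} (hd : 1 ≤ d) :
    ∃ η > 0, ∀ j : ℕ, 1 ≤ j → j ≠ d → 2 * η ≤ |ballConst d - ballConst j| := by
  have hanti : StrictAnti fun j => ballConst (j + 1) := strictAnti_nat_of_succ_lt ballConst_succ_lt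
  obtain ⟨d, rfl⟩ := Nat.exists_eq_add_of_le' hd
  have hup : 0 < ballConst (d + 1) - ballConst (d + 2) := sub_pos.2 (hanti d.lt_succ_self)
  have upper : ∀ j, d < j → ballConst (d + 1) - ballConst (d + 2) ≤
      |ballConst (d + 1) - ballConst (j + 1)| := fun j hj =>
    (sub_le_sub_left (hanti.antitone (Nat.succ_le_of_lt hj)) _).trans (le_abs_self _)
  -- Here `d` is the dimension minus one: dimension one has no lower neighbour, and otherwise the
  -- gap is the smaller of the two neighbouring ones.
  rcases d with _ | d
  · refine ⟨_, half_pos hup, fun j h1 h2 => ?_⟩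
    obtain ⟨j, rfl⟩ := Nat.exists_eq_add_of_le' h1
    linarith [upper j (by omega)]
  · have hlo : 0 < ballConst (d + 1) - ballConst (d + 2) := sub_pos.2 (hanti d.lt_succ_self)
    refine ⟨_, half_pos (lt_min hup hlo), fun j h1 h2 => ?_⟩
    obtain ⟨j, rfl⟩ := Nat.exists_eq_add_of_le' h1
    rcases lt_or_gt_of_ne (show j ≠ d + 1 by omega) with h | h
    · have h3 : ballConst (d + 1) ≤ ballConst (j + 1) := hanti.antitone (Nat.lt_succ_iff.1 h)
      have h4 := neg_abs_le (ballConst (d + 1 + 1) - ballConst (j + 1))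
      have h5 := min_le_right (ballConst (d + 1 + 1) - ballConst (d + 1 + 2))
        (ballConst (d + 1) - ballConst (d + 2))
      have h6 : ballConst (d + 1 + 1) = ballConst (d + 2) := rfl
      linarith
    · have h5 := min_le_left (ballConst (d + 1 + 1) - ballConst (d + 1 + 2))
        (ballConst (d + 1) - ballConst (d + 2))
      linarith [upper j h]

end Slices

/-! ### Clustering coefficients as ratios of ordered pair counts. -/

section Clustering

theorem two_mul_ncard_edgeSet_induce {V : Type*} [Fintype V] (G : SimpleGraph V) (s : Set V) :
    2 * (G.induce s).edgeSet.ncard =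
      {p : V × V | p.1 ∈ s ∧ p.2 ∈ s ∧ G.Adj p.1 p.2}.ncard := by
  classical
  have h := (G.induce s).two_mul_card_edgeFinset
  rw [← Set.coe_toFinset (G.induce s).edgeSet, Set.ncard_coe_finset]
  change 2 * (G.induce s).edgeFinset.card = _
  rw [h, ← Set.ncard_coe_finset, ← Set.ncard_image_of_injective (f := Prod.map Subtype.val Subtype.val) _
    (Subtype.val_injective.prodMap Subtype.val_injective)]
  congr 1
  ext ⟨a, b⟩
  simp
  tauto

theorem two_mul_choose_ncard {V : Type*} [Finite V] (s : Set V) :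
    2 * s.ncard.choose 2 = {p : V × V | p.1 ∈ s ∧ p.2 ∈ s ∧ p.1 ≠ p.2}.ncard := by
  classical
  have := Fintype.ofFinite V
  have h : {p : V × V | p.1 ∈ s ∧ p.2 ∈ s ∧ p.1 ≠ p.2} = (s.toFinset.offDiag : Set (V × V)) := by
    ext p; simp
  rw [h, Set.ncard_coe_finset, Finset.offDiag_card, Set.ncard_eq_toFinset_card', Nat.choose_two_right,
    Nat.mul_div_cancel' (Nat.even_mul_pred_self _).two_dvd, Nat.mul_sub_one]

/-- Passing to ordered pairs doubles numerator and denominator alike; the convention `0 / 0 = 0`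
covers at most one neighbour. -/
theorem clusteringCoeff_eq {V : Type*} [Finite V] (G : SimpleGraph V) (v : V) :
    clusteringCoeff G v =
      ({p : V × V | G.Adj v p.1 ∧ G.Adj v p.2 ∧ G.Adj p.1 p.2}.ncard : ℝ) /
        {p : V × V | G.Adj v p.1 ∧ G.Adj v p.2 ∧ p.1 ≠ p.2}.ncard := by
  have := Fintype.ofFinite V
  have h1 := two_mul_ncard_edgeSet_induce G (G.neighborSet v)
  have h2 := two_mul_choose_ncard (G.neighborSet v)
  simp only [SimpleGraph.mem_neighborSet] at h1 h2
  rw [clusteringCoeff, ← h1, ← h2]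
  push_cast
  rw [mul_div_mul_left _ _ two_ne_zero]

/-- The number of ordered pairs of distinct indices `i`, `j` with `(y i, y j) ∈ S`. -/
noncomputable def pairCount {E : Type*} {m : ℕ} (S : Set (E × E)) (y : Fin m → E) : ℝ :=
  ∑ p ∈ (Finset.univ : Finset (Fin m)).offDiag, S.indicator 1 (y p.1, y p.2)

theorem pairCount_eq_ncard {E : Type*} {m : ℕ} (S : Set (E × E)) (y : Fin m → E) :
    pairCount S y = ({p : Fin m × Fin m | p.1 ≠ p.2 ∧ (y p.1, y p.2) ∈ S}.ncard : ℝ) := by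
  classical
  have h : {p : Fin m × Fin m | p.1 ≠ p.2 ∧ (y p.1, y p.2) ∈ S} =
      ((Finset.univ.offDiag.filter fun p : Fin m × Fin m => (y p.1, y p.2) ∈ S : Finset _) :
        Set (Fin m × Fin m)) := by
    ext p; simp
  rw [h, Set.ncard_coe_finset, pairCount, Finset.card_filter]
  push_cast
  refine Finset.sum_congr rfl fun p _ => ?_
  simp [Set.indicator_apply]

/-- The pairs of points at distance at most `r` from `x` and from each other. -/
def closePairs {E : Type*} [NormedAddCommGroup E] (x : E) (r : ℝ) : Set (E × E) :=
  {p | ‖p.1 - x‖ ≤ r ∧ ‖p.2 - x‖ ≤ r ∧ ‖p.1 - p.2‖ ≤ r}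

/-- The pairs of points at distance at most `r` from `x`. -/
def ballPairs {E : Type*} [NormedAddCommGroup E] (x : E) (r : ℝ) : Set (E × E) :=
  Metric.closedBall x r ×ˢ Metric.closedBall x r

/-- The local clustering coefficient is a ratio of two counts of ordered pairs. -/
theorem firstClusteringCoeff_geometricGraph {d m : ℕ} (r : ℝ)
    (z : Fin (m + 1) → EuclideanSpace ℝ (Fin d)) :
    firstClusteringCoeff (geometricGraph r z) =
      pairCount (closePairs (z 0) r) (fun i => z i.succ) /
        pairCount (ballPairs (z 0) r) (fun i => z i.succ) := by
  -- Vertex 0 is not its own neighbour, so all counted pairs lie in the image of this map.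
  have inj : Function.Injective (Prod.map Fin.succ Fin.succ : Fin m × Fin m → _) :=
    (Fin.succ_injective m).prodMap (Fin.succ_injective m)
  rw [firstClusteringCoeff, dif_pos m.succ_pos, clusteringCoeff_eq, pairCount_eq_ncard,
    pairCount_eq_ncard, ← Set.ncard_image_of_injective _ inj, ← Set.ncard_image_of_injective _ inj]
  congr 3
  · ext ⟨a, b⟩
    refine Fin.cases ?_ (fun i => ?_) a <;> refine Fin.cases ?_ (fun j => ?_) b <;>
      simp [geometricGraph, closePairs, Fin.succ_ne_zero, (Fin.succ_ne_zero _).symm, norm_sub_rev (z 0)]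
    tauto
  · ext ⟨a, b⟩
    refine Fin.cases ?_ (fun i => ?_) a <;> refine Fin.cases ?_ (fun j => ?_) b <;>
      simp [geometricGraph, ballPairs, Fin.succ_ne_zero, (Fin.succ_ne_zero _).symm, dist_eq_norm,
        norm_sub_rev (z 0)]
    tauto

end Clustering

/-! ### Mean and variance of pair counts. -/

section PairCount

variable {E : Type*} [MeasurableSpace E] {m : ℕ}

variable (μ : Measure E) [IsProbabilityMeasure μ]

theorem map_eval_pair {i j : Fin m} (hij : i ≠ j) :
    (Measure.pi fun _ : Fin m => μ).map (fun y => (y i, y j)) = μ.prod μ := by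
  have h := (iIndepFun_pi (μ := fun _ : Fin m => μ) (X := fun _ => id)
    (fun _ => aemeasurable_id)).indepFun hij
  have h2 := (indepFun_iff_map_prod_eq_prod_map_map (measurable_pi_apply i).aemeasurable
    (measurable_pi_apply j).aemeasurable).1 h
  refine h2.trans ?_
  change (Measure.map (fun y : Fin m → E => y i) _).prod (Measure.map (fun y : Fin m → E => y j) _) = _
  rw [ (measurePreserving_eval (fun _ : Fin m => μ) i).map_eq,
    (measurePreserving_eval (fun _ : Fin m => μ) j).map_eq]

theorem memLp_pair_indicator {S : Set (E × E)} (hS : MeasurableSet S) (i j : Fin m) :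
    MemLp (fun y : Fin m → E => S.indicator (1 : E × E → ℝ) (y i, y j)) 2
      (Measure.pi fun _ : Fin m => μ) := by
  refine MemLp.of_bound (((measurable_const.indicator hS).comp
    ((measurable_pi_apply i).prodMk (measurable_pi_apply j))).aestronglyMeasurable) 1
    (Eventually.of_forall fun y => ?_)
  by_cases h : (y i, y j) ∈ S <;> simp [h]

theorem integral_pair_indicator {S : Set (E × E)} (hS : MeasurableSet S) {i j : Fin m}
    (hij : i ≠ j) :
    ∫ y, S.indicator (1 : E × E → ℝ) (y i, y j) ∂(Measure.pi fun _ : Fin m => μ) =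
      (μ.prod μ).real S := by
  rw [← map_eval_pair μ hij, ← integral_indicator_one hS, integral_map (by fun_prop)]
  exact (measurable_one.indicator hS).aestronglyMeasurable

theorem integral_pairCount {S : Set (E × E)} (hS : MeasurableSet S) :
    ∫ y, pairCount S y ∂(Measure.pi fun _ : Fin m => μ) =
      (m * m - m : ℝ) * (μ.prod μ).real S := by
  unfold pairCount
  rw [integral_finsetSum _ fun p _ => (memLp_pair_indicator μ hS p.1 p.2).integrable one_le_two,
    Finset.sum_congr rfl fun p hp => integral_pair_indicator μ hS (Finset.mem_offDiag.1 hp).2.2]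
  rw [Finset.sum_const, Finset.offDiag_card, nsmul_eq_mul, Nat.cast_sub (Nat.le_mul_self _)]
  simp

theorem measureReal_pi_forall_mem (B : Set E) (t : Finset (Fin m)) :
    (Measure.pi fun _ : Fin m => μ).real {y | ∀ i ∈ t, y i ∈ B} = μ.real B ^ t.card := by
  classical
  have h : {y : Fin m → E | ∀ i ∈ t, y i ∈ B} =
      Set.univ.pi fun i => if i ∈ t then B else Set.univ := by
    ext y
    simp only [Set.mem_ofPred_eq, Set.mem_univ_pi]
    refine forall_congr' fun i => ?_
    by_cases hi : i ∈ t <;> simp [hi]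
  rw [h, measureReal_def, Measure.pi_pi, ENNReal.toReal_prod, ← Finset.prod_const,
    ← Finset.prod_subset (Finset.subset_univ t)]
  · exact Finset.prod_congr rfl fun i hi => by simp [hi, measureReal_def]
  · intro i _ hi; simp [hi]

/-- The product of the means is nonnegative and can be dropped. If both indicators equal one, every
point indexed by `{i, j, k, l}` lies in `B`, hence the exponent counts distinct indices. -/
theorem covariance_pair_indicator_le {S : Set (E × E)} (hS : MeasurableSet S) {B : Set E}
    (hSB : S ⊆ B ×ˢ B) {i j k l : Fin m} :
    cov[fun y => S.indicator (1 : E × E → ℝ) (y i, y j),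
      fun y => S.indicator (1 : E × E → ℝ) (y k, y l); Measure.pi fun _ : Fin m => μ] ≤
      μ.real B ^ ({i, j, k, l} : Finset (Fin m)).card := by
  rw [covariance_eq_sub (memLp_pair_indicator μ hS i j) (memLp_pair_indicator μ hS k l),
    ← measureReal_pi_forall_mem]
  have hnn : ∀ i j : Fin m, 0 ≤ ∫ y, S.indicator (1 : E × E → ℝ) (y i, y j)
      ∂(Measure.pi fun _ : Fin m => μ) := fun i j =>
    integral_nonneg fun y => Set.indicator_nonneg (fun _ _ => zero_le_one) _
  refine (sub_le_self _ (mul_nonneg (hnn i j) (hnn k l))).trans ?_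
  have mT : ∀ i j : Fin m, MeasurableSet {y : Fin m → E | (y i, y j) ∈ S} := fun i j =>
    hS.preimage ((measurable_pi_apply i).prodMk (measurable_pi_apply j))
  have e : ((fun y => S.indicator (1 : E × E → ℝ) (y i, y j)) *
      fun y => S.indicator (1 : E × E → ℝ) (y k, y l)) =
      ({y : Fin m → E | (y i, y j) ∈ S} ∩ {y : Fin m → E | (y k, y l) ∈ S}).indicator 1 := by
    ext y
    by_cases h1 : (y i, y j) ∈ S <;> by_cases h2 : (y k, y l) ∈ S <;> simp [h1, h2]
  rw [e, integral_indicator_one ((mT i j).inter (mT k l))]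
  refine measureReal_mono ?_
  rintro y ⟨h1, h2⟩ a ha
  have h1 := hSB h1
  have h2 := hSB h2
  simp only [Finset.mem_insert, Finset.mem_singleton] at ha
  rcases ha with rfl | rfl | rfl | rfl
  exacts [h1.1, h1.2, h2.1, h2.2]

theorem covariance_pair_indicator_eq_zero {S : Set (E × E)} (hS : MeasurableSet S)
    {i j k l : Fin m} (hik : i ≠ k) (hil : i ≠ l) (hjk : j ≠ k) (hjl : j ≠ l) :
    cov[fun y => S.indicator (1 : E × E → ℝ) (y i, y j),
      fun y => S.indicator (1 : E × E → ℝ) (y k, y l); Measure.pi fun _ : Fin m => μ] = 0 := by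
  have h := (iIndepFun_pi (μ := fun _ : Fin m => μ) (X := fun _ => id)
    (fun _ => aemeasurable_id)).indepFun_prodMk_prodMk (fun i => measurable_pi_apply i)
      i j k l hik hil hjk hjl
  have hm : Measurable (S.indicator (1 : E × E → ℝ)) := measurable_one.indicator hS
  exact (h.comp hm hm).covariance_eq_zero (memLp_pair_indicator μ hS i j)
    (memLp_pair_indicator μ hS k l)

/-- A pair of distinct indices meeting `{i, j}` contributes at most `p ^ 2` if it equals `{i, j}`
and at most `p ^ 3` otherwise, `p` being the mass of `B`. -/
theorem sum_covariance_pair_indicator_le {S : Set (E × E)} (hS : MeasurableSet S) {B : Set E}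
    (hSB : S ⊆ B ×ˢ B) {i j : Fin m} (hij : i ≠ j) :
    ∑ q ∈ (Finset.univ : Finset (Fin m)).offDiag,
      cov[fun y => S.indicator (1 : E × E → ℝ) (y i, y j),
        fun y => S.indicator (1 : E × E → ℝ) (y q.1, y q.2); Measure.pi fun _ : Fin m => μ] ≤
      4 * (2 * μ.real B ^ 2 + m * μ.real B ^ 3) := by
  set p := μ.real B
  have hp : 0 ≤ p := measureReal_nonneg
  let G : Fin m → ℝ := fun e => p ^ ({i, j, e} : Finset (Fin m)).card
  have hG : ∀ e, 0 ≤ G e := fun e => pow_nonneg hp _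
  have hGle : ∀ e, G e ≤ (if e = i then p ^ 2 else 0) + (if e = j then p ^ 2 else 0) + p ^ 3 := by
    intro e
    have h2 := pow_nonneg hp 2
    have h3 := pow_nonneg hp 3
    by_cases hi : e = i
    · subst hi
      have : ({e, j, e} : Finset (Fin m)).card = 2 := by
        rw [← Finset.card_pair hij]; congr 1; ext; simp; tauto
      simp only [G, this, if_true]
      split_ifs <;> linarith
    by_cases hj : e = j
    · subst hj
      have : ({i, e, e} : Finset (Fin m)).card = 2 := by
        rw [← Finset.card_pair hij]; congr 1; ext; simp
      simp only [G, this, if_true]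
      split_ifs <;> linarith
    · have : ({i, j, e} : Finset (Fin m)).card = 3 :=
        Finset.card_eq_three.2 ⟨i, j, e, hij, Ne.symm hi, Ne.symm hj, rfl⟩
      simp only [G, this, hi, hj, if_false]
      linarith
  have hGsum : ∑ e, G e ≤ 2 * p ^ 2 + m * p ^ 3 := by
    refine (Finset.sum_le_sum fun e _ => hGle e).trans_eq ?_
    simp [Finset.sum_add_distrib]
    ring
  -- One term for each way an endpoint of `q` can coincide with `i` or `j`. Overcounting is harmless
  -- since `G` is nonnegative, and the four terms produce the factor 4.
  let u : Fin m × Fin m → ℝ := fun q => (if q.1 = i then G q.2 else 0) +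
    (if q.1 = j then G q.2 else 0) + (if q.2 = i then G q.1 else 0) + (if q.2 = j then G q.1 else 0)
  have hu : ∀ q, 0 ≤ u q := fun q => by
    have h1 := hG q.1
    have h2 := hG q.2
    simp only [u]
    split_ifs <;> linarith
  have husum : ∑ q, u q = 4 * ∑ e, G e := by
    rw [Fintype.sum_prod_type]
    simp only [u, Finset.sum_add_distrib]
    simp [Finset.sum_ite_irrel, Finset.sum_ite_eq', Finset.mul_sum]
    rw [← Finset.mul_sum]
    ring
  have hle : ∀ q : Fin m × Fin m,
      cov[fun y => S.indicator (1 : E × E → ℝ) (y i, y j),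
        fun y => S.indicator (1 : E × E → ℝ) (y q.1, y q.2); Measure.pi fun _ : Fin m => μ] ≤
      u q := by
    rintro ⟨k, l⟩
    have hb := covariance_pair_indicator_le μ hS hSB (i := i) (j := j) (k := k) (l := l)
    have h1 := hG k
    have h2 := hG l
    by_cases hki : k = i
    · have e : ({i, j, k, l} : Finset (Fin m)) = {i, j, l} := by subst hki; ext; simp; tauto
      rw [e] at hb
      refine hb.trans (show G l ≤ u (k, l) from ?_)
      simp only [u, if_pos hki]
      split_ifs <;> linarith
    by_cases hkj : k = j
    · have e : ({i, j, k, l} : Finset (Fin m)) = {i, j, l} := by subst hkj; ext; simp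
      rw [e] at hb
      refine hb.trans (show G l ≤ u (k, l) from ?_)
      simp only [u, if_pos hkj]
      split_ifs <;> linarith
    by_cases hli : l = i
    · have e : ({i, j, k, l} : Finset (Fin m)) = {i, j, k} := by subst hli; ext; simp; tauto
      rw [e] at hb
      refine hb.trans (show G k ≤ u (k, l) from ?_)
      simp only [u, if_pos hli]
      split_ifs <;> linarith
    by_cases hlj : l = j
    · have e : ({i, j, k, l} : Finset (Fin m)) = {i, j, k} := by subst hlj; ext; simp; tauto
      rw [e] at hb
      refine hb.trans (show G k ≤ u (k, l) from ?_)
      simp only [u, if_pos hlj]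
      split_ifs <;> linarith
    · exact (covariance_pair_indicator_eq_zero μ hS (Ne.symm hki) (Ne.symm hli) (Ne.symm hkj)
        (Ne.symm hlj)).trans_le (hu _)
  calc _ ≤ ∑ q ∈ (Finset.univ : Finset (Fin m)).offDiag, u q := Finset.sum_le_sum fun q _ => hle q
    _ ≤ ∑ q, u q := Finset.sum_le_sum_of_subset_of_nonneg (Finset.subset_univ _) fun q _ _ => hu q
    _ ≤ _ := by rw [husum]; linarith

theorem variance_pairCount_le {S : Set (E × E)} (hS : MeasurableSet S) {B : Set E}
    (hSB : S ⊆ B ×ˢ B) :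
    Var[pairCount S; Measure.pi fun _ : Fin m => μ] ≤
      (m * m - m) * (4 * (2 * μ.real B ^ 2 + m * μ.real B ^ 3)) := by
  unfold pairCount
  rw [variance_fun_sum' fun p _ => memLp_pair_indicator μ hS p.1 p.2]
  refine (Finset.sum_le_sum fun p hp =>
    sum_covariance_pair_indicator_le μ hS hSB (Finset.mem_offDiag.1 hp).2.2).trans_eq ?_
  rw [Finset.sum_const, Finset.offDiag_card, nsmul_eq_mul, Nat.cast_sub (Nat.le_mul_self _)]
  simp

end PairCount

/-! ### Local masses at Lebesgue points. -/

section Density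

open scoped Pointwise

theorem closePairs_subset_ballPairs {E : Type*} [NormedAddCommGroup E] (x : E) (r : ℝ) :
    closePairs x r ⊆ ballPairs x r :=
  fun p hp => ⟨by simpa [dist_eq_norm] using hp.1, by simpa [dist_eq_norm] using hp.2.1⟩

theorem measureReal_withDensity_ofReal {α : Type*} [MeasurableSpace α] {μ : Measure α} {f : α → ℝ}
    (hf0 : ∀ x, 0 ≤ f x) (hf : AEStronglyMeasurable f μ) {s : Set α} (hs : MeasurableSet s) :
    (μ.withDensity fun x => ENNReal.ofReal (f x)).real s = ∫ x in s, f x ∂μ := by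
  rw [measureReal_def, withDensity_apply _ hs,
    integral_eq_lintegral_of_nonneg_ae (Eventually.of_forall hf0) hf.restrict]

theorem measureReal_prod_withDensity_ofReal {α : Type*} [MeasurableSpace α] {μ : Measure α} [SFinite μ]
    {f : α → ℝ} (hf0 : ∀ x, 0 ≤ f x)
    (hf : Integrable f μ) {S : Set (α × α)} (hS : MeasurableSet S) :
    ((μ.withDensity fun x => ENNReal.ofReal (f x)).prod
      (μ.withDensity fun x => ENNReal.ofReal (f x))).real S =
        ∫ z in S, f z.1 * f z.2 ∂(μ.prod μ) := by
  have hm := hf.aestronglyMeasurable.aemeasurable.ennreal_ofReal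
  rw [prod_withDensity₀ hm hm]
  simp_rw [← ENNReal.ofReal_mul (hf0 _)]
  exact measureReal_withDensity_ofReal (fun z => mul_nonneg (hf0 _) (hf0 _))
    (hf.mul_prod hf).aestronglyMeasurable hS

/-- On a product of two copies of `B`, a density `f` is nearly the constant `c` when `f` is nearly
`c` on average over `B`. -/
theorem abs_setIntegral_mul_sub_le {α : Type*} [MeasurableSpace α] {μ : Measure α} [SFinite μ]
    {f : α → ℝ} (hf0 : ∀ x, 0 ≤ f x) (hf : Integrable f μ)
    {B : Set α} (hB : μ B ≠ ⊤) {S : Set (α × α)} (hS : MeasurableSet S) (hSB : S ⊆ B ×ˢ B) {c : ℝ}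
    (hc : 0 ≤ c) :
    |∫ z in S, f z.1 * f z.2 ∂(μ.prod μ) - c ^ 2 * (μ.prod μ).real S| ≤
      (∫ y in B, ‖f y - c‖ ∂μ) * (∫ y in B, f y ∂μ) +
        c * μ.real B * ∫ y in B, ‖f y - c‖ ∂μ := by
  have : IsFiniteMeasure (μ.restrict B) := ⟨by simpa using hB.lt_top⟩
  have iB : Integrable f (μ.restrict B) := hf.restrict
  have ic : Integrable (fun y => ‖f y - c‖) (μ.restrict B) := (iB.sub (integrable_const c)).norm
  have hfin : (μ.prod μ) S ≠ ⊤ := by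
    refine ne_top_of_le_ne_top ?_ (measure_mono hSB)
    rw [Measure.prod_prod]; exact ENNReal.mul_ne_top hB hB
  have i1 : Integrable (fun z : α × α => ‖f z.1 - c‖ * f z.2) ((μ.prod μ).restrict (B ×ˢ B)) := by
    rw [← Measure.prod_restrict]; exact ic.mul_prod iB
  have i2 : Integrable (fun z : α × α => c * ‖f z.2 - c‖) ((μ.prod μ).restrict (B ×ˢ B)) := by
    rw [← Measure.prod_restrict]; exact (integrable_const c).mul_prod ic
  have e1 : ∫ z in B ×ˢ B, ‖f z.1 - c‖ * f z.2 ∂(μ.prod μ) =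
      (∫ y in B, ‖f y - c‖ ∂μ) * ∫ y in B, f y ∂μ := by
    rw [← Measure.prod_restrict]
    exact integral_prod_mul (fun y => ‖f y - c‖) f
  have e2 : ∫ z in B ×ˢ B, c * ‖f z.2 - c‖ ∂(μ.prod μ) =
      c * μ.real B * ∫ y in B, ‖f y - c‖ ∂μ := by
    rw [← Measure.prod_restrict]
    refine (integral_prod_mul (fun _ => c) fun y => ‖f y - c‖).trans ?_
    simp [mul_comm]
  have ec : c ^ 2 * (μ.prod μ).real S = ∫ _ in S, c ^ 2 ∂(μ.prod μ) := by simp [mul_comm]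
  rw [ec, ← integral_sub (hf.mul_prod hf).restrict (integrableOn_const hfin), ← e1, ← e2,
    ← integral_add i1 i2, ← Real.norm_eq_abs]
  refine (norm_integral_le_integral_norm _).trans ?_
  refine (setIntegral_mono_on ((hf.mul_prod hf).restrict.sub (integrableOn_const hfin)).norm
    ((i1.add i2).mono_measure (Measure.restrict_mono hSB le_rfl)) hS fun z _ => ?_).trans
    (setIntegral_mono_set (i1.add i2) (Eventually.of_forall fun z =>
      add_nonneg (mul_nonneg (norm_nonneg _) (hf0 _)) (mul_nonneg hc (norm_nonneg _)))
      (Eventually.of_forall hSB))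
  calc ‖f z.1 * f z.2 - c ^ 2‖ = ‖(f z.1 - c) * f z.2 + c * (f z.2 - c)‖ := by congr 1; ring
    _ ≤ _ := by
      refine (norm_add_le _ _).trans ?_
      rw [norm_mul, norm_mul, Real.norm_of_nonneg (hf0 _), Real.norm_of_nonneg hc]
      exact le_rfl

variable {E : Type*} [NormedAddCommGroup E] [NormedSpace ℝ E] [FiniteDimensional ℝ E]
  [MeasurableSpace E] [BorelSpace E]

theorem measurableSet_closePairs (x : E) (r : ℝ) : MeasurableSet (closePairs x r) := by
  simp only [closePairs, Set.ofPred_and]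
  exact (measurableSet_le (by fun_prop) (by fun_prop)).inter
    ((measurableSet_le (by fun_prop) (by fun_prop)).inter
      (measurableSet_le (by fun_prop) (by fun_prop)))

/-- Translation by `(x, x)` and dilation by `r` in `E × E`, whose dimension is twice that of `E`. -/
theorem measureReal_closePairs (μ : Measure E) [μ.IsAddHaarMeasure] (x : E) {r : ℝ} (hr : 0 < r) :
    (μ.prod μ).real (closePairs x r) =
      (r ^ Module.finrank ℝ E) ^ 2 * (μ.prod μ).real (closePairs (0 : E) 1) := by
  have e : closePairs x r = (fun p : E × E => p + (-x, -x)) ⁻¹' (r • closePairs (0 : E) 1) := by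
    ext ⟨a, b⟩
    rw [Set.mem_preimage, Set.mem_smul_set_iff_inv_smul_mem₀ hr.ne']
    have h1 : ∀ v : E, ‖r⁻¹ • v‖ ≤ 1 ↔ ‖v‖ ≤ r := fun v => by
      rw [norm_smul, norm_inv, Real.norm_of_nonneg hr.le, inv_mul_le_iff₀ hr, mul_one]
    simp only [closePairs, Set.mem_ofPred_eq, Prod.mk_add_mk, Prod.smul_mk, sub_zero, ← smul_sub, h1,
      ← sub_eq_add_neg, sub_sub_sub_cancel_right]
  rw [e, measureReal_def, measure_preimage_add_right, Measure.addHaar_smul_of_nonneg _ hr.le,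
    ENNReal.toReal_mul, Module.finrank_prod, ENNReal.toReal_ofReal (by positivity), ← measureReal_def,
    ← two_mul, mul_comm 2, pow_mul]

variable {f : E → ℝ} {μ : Measure E}

/-- At almost every point, the masses of small balls and of the pairs of close points are
asymptotic to those of a uniform density. -/
theorem ae_tendsto_measureReal_closePairs_div [μ.IsAddHaarMeasure] (hf0 : ∀ x, 0 ≤ f x)
    (hf : Integrable f μ) {r : ℕ → ℝ} (hr : Tendsto r atTop (𝓝[>] 0)) :
    ∀ᵐ x ∂μ,
      Tendsto (fun n => (μ.withDensity fun x => ENNReal.ofReal (f x)).real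
        (Metric.closedBall x (r n)) / μ.real (Metric.closedBall x (r n))) atTop (𝓝 (f x)) ∧
      Tendsto (fun n => ((μ.withDensity fun x => ENNReal.ofReal (f x)).prod
        (μ.withDensity fun x => ENNReal.ofReal (f x))).real (closePairs x (r n)) /
          μ.real (Metric.closedBall x (r n)) ^ 2) atTop (𝓝 (f x ^ 2 *
            ((μ.prod μ).real (closePairs (0 : E) 1) /
              μ.real (Metric.closedBall (0 : E) 1) ^ 2))) := by
  filter_upwards [IsUnifLocDoublingMeasure.ae_tendsto_average_norm_sub μ hf.locallyIntegrable 1,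
    IsUnifLocDoublingMeasure.ae_tendsto_average μ hf.locallyIntegrable 1] with x h1 h2
  have hpos : ∀ᶠ n in atTop, 0 < r n := hr.eventually self_mem_nhdsWithin
  have hmem : ∀ᶠ n in atTop, x ∈ Metric.closedBall x (1 * r n) :=
    hpos.mono fun n hn => by simpa using hn.le
  replace h1 := h1 (fun _ => x) r hr hmem
  replace h2 := h2 (fun _ => x) r hr hmem
  simp only [setAverage_eq, smul_eq_mul] at h1 h2
  have hp : ∀ n, (μ.withDensity fun x => ENNReal.ofReal (f x)).real (Metric.closedBall x (r n)) =
      ∫ y in Metric.closedBall x (r n), f y ∂μ := fun n =>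
    measureReal_withDensity_ofReal hf0 hf.aestronglyMeasurable measurableSet_closedBall
  refine ⟨h2.congr fun n => by rw [hp, div_eq_inv_mul], ?_⟩
  set w := (μ.prod μ).real (closePairs (0 : E) 1) / μ.real (Metric.closedBall (0 : E) 1) ^ 2
  have hV : 0 < μ.real (Metric.closedBall (0 : E) 1) :=
    ENNReal.toReal_pos (Metric.measure_closedBall_pos μ _ one_pos).ne' measure_closedBall_lt_top.ne
  have hβ : ∀ n, 0 < r n → μ.real (Metric.closedBall x (r n)) =
      r n ^ Module.finrank ℝ E * μ.real (Metric.closedBall (0 : E) 1) := fun n hn => by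
    rw [measureReal_def, Measure.addHaar_closedBall' μ x hn.le, ENNReal.toReal_mul,
      ENNReal.toReal_ofReal (by positivity), measureReal_def]
  -- This is the bound of `abs_setIntegral_mul_sub_le` with `c = f x`, divided by the squared volume
  -- of the ball.
  have hlim : Tendsto (fun n => ((μ.real (Metric.closedBall x (r n)))⁻¹ *
      ∫ y in Metric.closedBall x (r n), ‖f y - f x‖ ∂μ) *
        ((μ.real (Metric.closedBall x (r n)))⁻¹ * ∫ y in Metric.closedBall x (r n), f y ∂μ) +
      f x * ((μ.real (Metric.closedBall x (r n)))⁻¹ *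
        ∫ y in Metric.closedBall x (r n), ‖f y - f x‖ ∂μ)) atTop (𝓝 0) := by
    simpa using (h1.mul h2).add (h1.const_mul (f x))
  rw [tendsto_iff_norm_sub_tendsto_zero]
  refine squeeze_zero' (Eventually.of_forall fun _ => norm_nonneg _) ?_ hlim
  filter_upwards [hpos] with n hn
  have hb : 0 < μ.real (Metric.closedBall x (r n)) := by rw [hβ n hn]; positivity
  have hw : f x ^ 2 * w = f x ^ 2 * (μ.prod μ).real (closePairs x (r n)) /
      μ.real (Metric.closedBall x (r n)) ^ 2 := by
    rw [measureReal_closePairs μ x hn, hβ n hn]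
    have : r n ^ Module.finrank ℝ E ≠ 0 := by positivity
    simp only [w]
    field_simp
  have key := abs_setIntegral_mul_sub_le hf0 hf (B := Metric.closedBall x (r n))
    measure_closedBall_lt_top.ne (measurableSet_closePairs x (r n))
    (closePairs_subset_ballPairs x (r n)) (hf0 x)
  rw [measureReal_prod_withDensity_ofReal hf0 hf (measurableSet_closePairs x (r n)), hw, ← sub_div,
    norm_div, Real.norm_eq_abs, Real.norm_of_nonneg (by positivity), div_le_iff₀ (by positivity)]
  refine key.trans_eq ?_
  field_simp

end Density

/-! ### Chebyshev's inequality and ratios of counts. -/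

section Concentration

theorem measure_pairCount_deviation_le {E : Type*} [MeasurableSpace E] (μ : Measure E)
    [IsProbabilityMeasure μ] {m : ℕ} (hm : 2 ≤ m) {S : Set (E × E)} (hS : MeasurableSet S)
    {B : Set E} (hSB : S ⊆ B ×ˢ B) (hB : 0 < μ.real B) {η : ℝ} (hη : 0 < η) :
    (Measure.pi fun _ : Fin m => μ) {y | η ≤ |pairCount S y / ((m * m - m) * μ.real B ^ 2) -
      (μ.prod μ).real S / μ.real B ^ 2|} ≤
      ENNReal.ofReal (8 * (2 + m * μ.real B) / (η ^ 2 * (m * μ.real B) ^ 2)) := by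
  set p := μ.real B
  have hm' : (2 : ℝ) ≤ m := by exact_mod_cast hm
  -- Valid for `m ≥ 2`; this loss of a factor 2 turns the 4 of the variance bound into 8.
  have hM : (m : ℝ) ^ 2 / 2 ≤ m * m - m := by nlinarith
  have hM0 : 0 < (m : ℝ) * m - m := by nlinarith
  have hN : 0 < ((m : ℝ) * m - m) * p ^ 2 := by positivity
  have hLp : MemLp (pairCount S) 2 (Measure.pi fun _ : Fin m => μ) := by
    unfold pairCount
    exact memLp_finsetSum _ fun q _ => memLp_pair_indicator μ hS q.1 q.2
  have hch := meas_ge_le_variance_div_sq hLp (mul_pos hη hN)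
  rw [integral_pairCount μ hS] at hch
  have hset : {y : Fin m → E | η ≤ |pairCount S y / ((m * m - m) * p ^ 2) -
      (μ.prod μ).real S / p ^ 2|} = {y | η * (((m : ℝ) * m - m) * p ^ 2) ≤
        |pairCount S y - (m * m - m) * (μ.prod μ).real S|} := by
    ext y
    have e : pairCount S y / ((m * m - m) * p ^ 2) - (μ.prod μ).real S / p ^ 2 =
        (pairCount S y - (m * m - m) * (μ.prod μ).real S) / ((m * m - m) * p ^ 2) := by
      rw [sub_div, mul_div_mul_left _ _ hM0.ne']
    simp only [Set.mem_ofPred_eq]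
    rw [e, abs_div, abs_of_pos hN, le_div_iff₀ hN]
  rw [hset]
  refine hch.trans (ENNReal.ofReal_le_ofReal ?_)
  refine (div_le_div_of_nonneg_right (variance_pairCount_le μ hS hSB) (by positivity)).trans ?_
  have e1 : ((m : ℝ) * m - m) * (4 * (2 * p ^ 2 + m * p ^ 3)) / (η * ((m * m - m) * p ^ 2)) ^ 2 =
      4 * (2 + m * p) / (η ^ 2 * ((m * m - m) * p ^ 2)) := by
    field_simp
  have e2 : 8 * (2 + m * p) / (η ^ 2 * (m * p) ^ 2) =
      4 * (2 + m * p) / (η ^ 2 * (m ^ 2 / 2 * p ^ 2)) := by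
    field_simp; norm_num
  rw [e1, e2]
  gcongr

/-- A ratio of two pair counts concentrates when the mean number of points in `B m` tends to
infinity. -/
theorem tendsto_measure_pairCount_ratio {E : Type*} [MeasurableSpace E] (μ : Measure E)
    [IsProbabilityMeasure μ] {S : ℕ → Set (E × E)} (hS : ∀ m, MeasurableSet (S m))
    {B : ℕ → Set E} (hB : ∀ m, MeasurableSet (B m)) (hSB : ∀ m, S m ⊆ B m ×ˢ B m)
    (hmB : Tendsto (fun m : ℕ => (m : ℝ) * μ.real (B m)) atTop atTop) {w : ℝ}
    (hw : Tendsto (fun m => (μ.prod μ).real (S m) / μ.real (B m) ^ 2) atTop (𝓝 w)) {ε : ℝ}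
    (hε : 0 < ε) :
    Tendsto (fun m => (Measure.pi fun _ : Fin m => μ)
      {y | ε ≤ |pairCount (S m) y / pairCount (B m ×ˢ B m) y - w|}) atTop (𝓝 0) := by
  -- Dividing both counts by `(m * m - m) * p ^ 2` brings them near `w` and `1`, where division is
  -- continuous. A deviation of the ratio then forces one of two Chebyshev events, hence the factor
  -- 2 in `hlim`.
  have hcont : ContinuousAt (fun q : ℝ × ℝ => q.1 / q.2) (w, 1) :=
    continuousAt_fst.div continuousAt_snd one_ne_zero
  obtain ⟨δ, hδ, hδε⟩ := Metric.continuousAt_iff.1 hcont ε hε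
  have hlim : Tendsto (fun m : ℕ => 2 * ENNReal.ofReal
      (8 * (2 + m * μ.real (B m)) / ((δ / 2) ^ 2 * (m * μ.real (B m)) ^ 2))) atTop (𝓝 0) := by
    have h1 : Tendsto (fun t : ℝ => 8 * (2 + t) / ((δ / 2) ^ 2 * t ^ 2)) atTop (𝓝 0) := by
      have h2 : Tendsto (fun t : ℝ => 8 / (δ / 2) ^ 2 * (2 * (t⁻¹ * t⁻¹) + t⁻¹)) atTop (𝓝 0) := by
        simpa using (((tendsto_inv_atTop_zero (𝕜 := ℝ).mul tendsto_inv_atTop_zero).const_mul 2).add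
          tendsto_inv_atTop_zero).const_mul (8 / (δ / 2) ^ 2)
      refine h2.congr' ?_
      filter_upwards [eventually_gt_atTop 0] with t ht
      field_simp
    have h3 := ENNReal.Tendsto.const_mul (a := 2) (ENNReal.tendsto_ofReal (h1.comp hmB))
      (Or.inr ENNReal.ofNat_ne_top)
    simpa using h3
  refine tendsto_of_tendsto_of_tendsto_of_le_of_le' tendsto_const_nhds hlim
    (Eventually.of_forall fun _ => zero_le) ?_
  filter_upwards [eventually_ge_atTop 2, hmB.eventually_gt_atTop 0,
    Metric.tendsto_nhds.1 hw (δ / 2) (half_pos hδ)] with m hm hpos hwm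
  set p := μ.real (B m)
  have hp : 0 < p := pos_of_mul_pos_right hpos (Nat.cast_nonneg m)
  have hm' : (2 : ℝ) ≤ m := by exact_mod_cast hm
  have hM0 : 0 < (m : ℝ) * m - m := by nlinarith
  have hN : ((m : ℝ) * m - m) * p ^ 2 ≠ 0 := by positivity
  have d1 := measure_pairCount_deviation_le μ hm (hS m) (hSB m) hp (half_pos hδ)
  have d2 := measure_pairCount_deviation_le μ hm ((hB m).prod (hB m)) subset_rfl hp (half_pos hδ)
  have e1 : (μ.prod μ).real (B m ×ˢ B m) / p ^ 2 = 1 := by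
    rw [measureReal_prod_prod, ← pow_two, div_self (by positivity)]
  rw [e1] at d2
  rw [two_mul]
  refine le_trans (measure_mono ?_) ((measure_union_le _ _).trans (add_le_add d1 d2))
  intro y hy
  by_contra hcon
  simp only [Set.mem_union, Set.mem_ofPred_eq, not_or, not_le] at hcon hy
  refine absurd (hδε (x := (pairCount (S m) y / ((m * m - m) * p ^ 2),
    pairCount (B m ×ˢ B m) y / ((m * m - m) * p ^ 2))) ?_) (not_lt.2 ?_)
  · rw [Prod.dist_eq, max_lt_iff]
    refine ⟨?_, by rw [Real.dist_eq]; linarith [hcon.2]⟩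
    refine (dist_triangle _ _ _).trans_lt ((add_lt_add ?_ hwm).trans_eq (add_halves δ))
    rw [Real.dist_eq]; exact hcon.1
  · rw [Real.dist_eq, div_div_div_cancel_right₀ hN, div_one]
    exact hy

end Concentration

/-! ### Conditioning on the first vertex, and the conclusion. -/

/-- The convergence in probability conditionally on the position `x` of the first vertex. -/
theorem ae_tendsto_measure_clustering {d : ℕ} (hd : 1 ≤ d)
    {f : EuclideanSpace ℝ (Fin d) → ℝ} (hf0 : ∀ x, 0 ≤ f x) (hf : Integrable f volume)
    {ν : Measure (EuclideanSpace ℝ (Fin d))} [IsProbabilityMeasure ν]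
    (hν : ν = volume.withDensity fun x => ENNReal.ofReal (f x))
    {r : ℕ → ℝ} (hr_nonneg : ∀ n, 0 ≤ r n) (hr_zero : Tendsto r atTop (𝓝 0))
    (hr_deg : Tendsto (fun n : ℕ => (n : ℝ) * r n ^ d) atTop atTop) {ε : ℝ} (hε : 0 < ε) :
    ∀ᵐ x ∂ν, Tendsto (fun m => (Measure.pi fun _ : Fin m => ν)
      {y | ε ≤ |pairCount (closePairs x (r m)) y / pairCount (ballPairs x (r m)) y - ballConst d|})
        atTop (𝓝 0) := by
  have hpos : ∀ᶠ n in atTop, 0 < r n := by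
    filter_upwards [hr_deg.eventually_gt_atTop 0] with n hn
    refine (hr_nonneg n).lt_of_ne fun h => ?_
    rw [← h, zero_pow (by omega), mul_zero] at hn
    exact lt_irrefl _ hn
  have hr : Tendsto r atTop (𝓝[>] 0) := tendsto_nhdsWithin_iff.2 ⟨hr_zero, hpos⟩
  have hfm := hf.aestronglyMeasurable.aemeasurable.ennreal_ofReal
  have hV : 0 < volume.real (Metric.closedBall (0 : EuclideanSpace ℝ (Fin d)) 1) :=
    ENNReal.toReal_pos (Metric.measure_closedBall_pos _ _ one_pos).ne' measure_closedBall_lt_top.ne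
  have hw : (volume.prod volume).real (closePairs (0 : EuclideanSpace ℝ (Fin d)) 1) /
      volume.real (Metric.closedBall (0 : EuclideanSpace ℝ (Fin d)) 1) ^ 2 = ballConst d := by
    rw [div_eq_iff (by positivity), measureReal_def volume, ballConst_mul_sq]
    simp [closePairs]
  have h1 := ae_tendsto_measureReal_closePairs_div hf0 hf hr
  rw [← hν, hw] at h1
  -- Points with `f x = 0` are `ν`-null. Positivity of `f x` makes the expected degree diverge and
  -- lets `f x ^ 2` cancel in the limit ratio.
  suffices h : ∀ᵐ x ∂volume, ENNReal.ofReal (f x) ≠ 0 →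
      Tendsto (fun m => (Measure.pi fun _ : Fin m => ν) {y | ε ≤ |pairCount (closePairs x (r m)) y /
        pairCount (ballPairs x (r m)) y - ballConst d|}) atTop (𝓝 0) by
    have := (ae_withDensity_iff' hfm).2 h
    rwa [← hν] at this
  filter_upwards [h1] with x hx hfx
  have hfx : 0 < f x := by simpa using hfx
  have hβ : ∀ n, volume.real (Metric.closedBall x (r n)) =
      r n ^ d * volume.real (Metric.closedBall (0 : EuclideanSpace ℝ (Fin d)) 1) := fun n => by
    rw [measureReal_def, Measure.addHaar_closedBall' volume x (hr_nonneg n), ENNReal.toReal_mul,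
      ENNReal.toReal_ofReal (pow_nonneg (hr_nonneg n) _), measureReal_def, finrank_euclideanSpace_fin]
  have hβpos : ∀ᶠ n in atTop, 0 < volume.real (Metric.closedBall x (r n)) :=
    hpos.mono fun n hn => by rw [hβ]; positivity
  refine tendsto_measure_pairCount_ratio ν (fun m => measurableSet_closePairs x (r m))
    (fun m => measurableSet_closedBall) (fun m => closePairs_subset_ballPairs x (r m)) ?_ ?_ hε
  · have h2 := (hr_deg.atTop_mul_const hV).atTop_mul_pos hfx hx.1
    refine h2.congr' ?_
    filter_upwards [hpos] with n hn
    rw [hβ]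
    have : r n ^ d ≠ 0 := by positivity
    field_simp
  · have h2 := hx.2.div (hx.1.pow 2) (by positivity)
    rw [mul_div_cancel_left₀ _ (by positivity)] at h2
    refine h2.congr' ?_
    filter_upwards [hβpos] with n hn
    rw [Pi.div_apply, div_pow, div_div_div_cancel_right₀ (by positivity)]

theorem measurable_pairCount_family {E : Type*} [MeasurableSpace E] {m : ℕ} {S : E → Set (E × E)}
    (hS : MeasurableSet {q : E × E × E | q.2 ∈ S q.1}) :
    Measurable fun q : E × (Fin m → E) => pairCount (S q.1) q.2 := by
  unfold pairCount
  refine Finset.measurable_sum _ fun p _ => ?_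
  have h : Measurable fun q : E × (Fin m → E) => (q.1, (q.2 p.1, q.2 p.2)) := by fun_prop
  exact (measurable_one.indicator (f := (1 : E × E × E → ℝ)) hS).comp h

/-- Splitting off the first point writes the probability as an integral over `x` of the conditional
ones, which are bounded by 1 and tend to 0 for almost every `x`. -/
theorem tendsto_measure_firstClusteringCoeff {d : ℕ} (hd : 1 ≤ d)
    {f : EuclideanSpace ℝ (Fin d) → ℝ} (hf0 : ∀ x, 0 ≤ f x) (hf : Integrable f volume)
    {ν : Measure (EuclideanSpace ℝ (Fin d))} [IsProbabilityMeasure ν]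
    (hν : ν = volume.withDensity fun x => ENNReal.ofReal (f x))
    {r : ℕ → ℝ} (hr_nonneg : ∀ n, 0 ≤ r n) (hr_zero : Tendsto r atTop (𝓝 0))
    (hr_deg : Tendsto (fun n : ℕ => (n : ℝ) * r n ^ d) atTop atTop) {ε : ℝ} (hε : 0 < ε) :
    Tendsto (fun m => (Measure.pi fun _ : Fin (m + 1) => ν)
      {z | ε ≤ |firstClusteringCoeff (geometricGraph (r m) z) - ballConst d|}) atTop (𝓝 0) := by
  let D : (m : ℕ) → Set (EuclideanSpace ℝ (Fin d) × (Fin m → EuclideanSpace ℝ (Fin d))) :=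
    fun m => {q | ε ≤ |pairCount (closePairs q.1 (r m)) q.2 / pairCount (ballPairs q.1 (r m)) q.2 -
      ballConst d|}
  have mD : ∀ m, MeasurableSet (D m) := by
    intro m
    refine measurableSet_le measurable_const (Measurable.abs (Measurable.sub_const (Measurable.div
      (measurable_pairCount_family (S := fun x => closePairs x (r m)) ?_)
      (measurable_pairCount_family (S := fun x => ballPairs x (r m)) ?_)) _))
    · simp only [closePairs, Set.ofPred_and]
      exact (measurableSet_le (by fun_prop) (by fun_prop)).inter
        ((measurableSet_le (by fun_prop) (by fun_prop)).inter
          (measurableSet_le (by fun_prop) (by fun_prop)))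
    · simp only [ballPairs, Set.mem_prod, Metric.mem_closedBall, Set.ofPred_and]
      exact (measurableSet_le (by fun_prop) (by fun_prop)).inter
          (measurableSet_le (by fun_prop) (by fun_prop))
  have e : ∀ m, (Measure.pi fun _ : Fin (m + 1) => ν)
      {z | ε ≤ |firstClusteringCoeff (geometricGraph (r m) z) - ballConst d|} =
      ∫⁻ x, (Measure.pi fun _ : Fin m => ν) (Prod.mk x ⁻¹' D m) ∂ν := by
    intro m
    have h := (measurePreserving_piFinSuccAbove (fun _ : Fin (m + 1) => ν) 0).measure_preimage
      (mD m).nullMeasurableSet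
    rw [Measure.prod_apply (mD m)] at h
    rw [← h]
    congr 1
    ext z
    rw [Set.mem_ofPred_eq, firstClusteringCoeff_geometricGraph]
    rfl
  simp_rw [e]
  rw [← lintegral_zero (μ := ν)]
  refine tendsto_lintegral_of_dominated_convergence (fun _ => 1)
    (fun m => measurable_measure_prodMk_left (mD m)) (fun m => Eventually.of_forall fun x => prob_le_one)
    (by simp) ?_
  exact ae_tendsto_measure_clustering hd hf0 hf hν hr_nonneg hr_zero hr_deg hε

/-- By the triangle inequality every other constant is strictly farther away, so the minimum is
attained, and only at `d`; the freedom left to `Δ` plays no role. -/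
theorem IsDimensionEstimate.eq_of_abs_sub_lt {Δ : (n : ℕ) → SimpleGraph (Fin n) → ℕ}
    (hΔ : IsDimensionEstimate Δ) {d : ℕ} (hd : 1 ≤ d) {η : ℝ}
    (hgap : ∀ j : ℕ, 1 ≤ j → j ≠ d → 2 * η ≤ |ballConst d - ballConst j|) {n : ℕ}
    {G : SimpleGraph (Fin n)} (h : |firstClusteringCoeff G - ballConst d| < η) : Δ n G = d := by
  have far : ∀ j, 1 ≤ j → j ≠ d → |firstClusteringCoeff G - ballConst d| <
      |firstClusteringCoeff G - ballConst j| := fun j h1 h2 => by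
    have h3 := hgap j h1 h2
    have h4 := abs_sub_le (ballConst d) (firstClusteringCoeff G) (ballConst j)
    rw [abs_sub_comm (ballConst d) (firstClusteringCoeff G)] at h4
    linarith
  obtain ⟨h1, h2⟩ := hΔ n G ⟨d, hd, fun j hj => by
    rcases eq_or_ne j d with rfl | hjd
    exacts [le_rfl, (far j hj hjd).le]⟩
  by_contra hne
  exact absurd (h2 d hd) (not_le.2 (far _ h1 hne))

theorem theorem4 {d : ℕ} (hd : 1 ≤ d)
    (f : EuclideanSpace ℝ (Fin d) → ℝ) (hf_nonneg : ∀ x, 0 ≤ f x)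
    (hf_int : Integrable f volume) (hf_one : ∫ x, f x = 1)
    (r : ℕ → ℝ) (hr_nonneg : ∀ n, 0 ≤ r n)
    (hr_zero : Tendsto r atTop (𝓝 0))
    (hr_deg : Tendsto (fun n : ℕ => (n : ℝ) * r n ^ d) atTop atTop)
    {Ω : Type*} [MeasurableSpace Ω] (P : Measure Ω) [IsProbabilityMeasure P]
    (X : (n : ℕ) → Fin n → Ω → EuclideanSpace ℝ (Fin d))
    (hX_indep : ∀ n, iIndepFun (X n) P)
    (hX_law : ∀ n i, HasLaw (X n i) (volume.withDensity fun x => ENNReal.ofReal (f x)) P) :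
    TendstoInMeasure P
      (fun n ω => firstClusteringCoeff (geometricGraph (r n) fun i => X n i ω)) atTop
      (fun _ => ballConst d) ∧
    ∀ Δ : (n : ℕ) → SimpleGraph (Fin n) → ℕ, IsDimensionEstimate Δ →
      TendstoInMeasure P
        (fun n ω => (Δ n (geometricGraph (r n) fun i => X n i ω) : ℝ)) atTop
        (fun _ => (d : ℝ)) := by
  have hprob : IsProbabilityMeasure (volume.withDensity fun x => ENNReal.ofReal (f x)) :=
    (hX_law 1 0).isProbabilityMeasure_iff.1 inferInstance
  have hr_zero' : Tendsto (fun m => r (m + 1)) atTop (𝓝 0) := (tendsto_add_atTop_iff_nat 1).2 hr_zero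
  have hr_deg' : Tendsto (fun m : ℕ => (m : ℝ) * r (m + 1) ^ d) atTop atTop := by
    have h1 := (tendsto_add_atTop_iff_nat 1).2 hr_deg
    -- With `m + 1` vertices only `m` points surround the first; the difference `r (m + 1) ^ d`
    -- vanishes in the limit.
    refine (h1.atTop_add (hr_zero'.pow d).neg).congr fun m => ?_
    push_cast
    ring
  have main : ∀ ε, 0 < ε → Tendsto (fun n => P {ω | ε ≤
      |firstClusteringCoeff (geometricGraph (r n) fun i => X n i ω) - ballConst d|}) atTop (𝓝 0) := by
    intro ε hε
    rw [← tendsto_add_atTop_iff_nat 1]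
    refine tendsto_of_tendsto_of_tendsto_of_le_of_le tendsto_const_nhds
      (tendsto_measure_firstClusteringCoeff hd hf_nonneg hf_int rfl (fun m => hr_nonneg (m + 1))
        hr_zero' hr_deg' hε) (fun _ => zero_le) fun m => ?_
    have hlaw := iIndepFun.hasLaw_pi (hX_law (m + 1)) (hX_indep (m + 1))
    -- Only an upper bound is needed, so measurability of the event does not have to be checked.
    have hle := Measure.le_map_apply hlaw.aemeasurable
      {z | ε ≤ |firstClusteringCoeff (geometricGraph (r (m + 1)) z) - ballConst d|}
    rw [hlaw.map_eq] at hle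
    exact hle
  refine ⟨tendstoInMeasure_iff_norm.2 main, fun Δ hΔ => tendstoInMeasure_iff_norm.2 fun ε hε => ?_⟩
  obtain ⟨η, hη, hgap⟩ := exists_ballConst_gap hd
  refine tendsto_of_tendsto_of_tendsto_of_le_of_le tendsto_const_nhds (main η hη)
    (fun _ => zero_le) fun n => measure_mono fun ω hω => ?_
  simp only [Set.mem_ofPred_eq] at hω ⊢
  set G := geometricGraph (r n) fun i => X n i ω
  by_contra hlt
  rw [not_le] at hlt
  rw [IsDimensionEstimate.eq_of_abs_sub_lt hΔ hd hgap hlt, sub_self, norm_zero] at hω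
  exact absurd hω (not_le.2 hε)
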